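/- Let $n$ and $r$ be nonnegative integers. Let $G(n,r)$ be the graph whose vertices are the $n\times n$ matrices of nonnegative integers with all row sums and all column sums equal to $r$ and in which two vertices $u,v$ are adjacent exactly when $v-u$ is a Markov move, that is, $v-u=\pm(e_{ij}+e_{kl}-e_{il}-e_{kj})$ for some $1\le i<k\le n$ and $1\le j<l\le n$, where $e_{ij}$ is the $n\times n$ matrix with a one in position $(i,j)$ and zeros elsewhere. A finite graph $G$ is $k$-connected if it has more than $k$ vertices and $G-X$ is connected for every set $X$ of fewer than $k$ vertices; the connectivity $\kappa(G)$ is the largest $k$ such that $G$ is $k$-connected, and $\delta(G)$ is the minimum degree of $G$. **Theorem.** If $r>2$, then $$\kappa(G(n,r))=\binom{n}{2}=\delta(G(n,r)).$$ In particular, the connectivity of $G(n,r)$ equals its minimum vertex degree. -/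

import Mathlib

section GraphConnectivity

/-- A finite graph `G` is `k`-connected if it has more than `k` vertices and `G - X` is connected
for every set `X` of fewer than `k` vertices. Here `G - X` is the subgraph induced on the
complement of `X`. -/
def IsKConnected {V : Type*} [Fintype V] (G : SimpleGraph V) (k : ℕ) : Prop :=
  k < Fintype.card V ∧ ∀ X : Finset V, X.card < k → (G.induce {v : V | v ∉ X}).Connected

/-- The connectivity `κ(G)` of a finite graph: the largest `k` such that `G` is `k`-connected
(see `isGreatest_vertexConnectivity`). -/
noncomputable def vertexConnectivity {V : Type*} [Fintype V] (G : SimpleGraph V) : ℕ :=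
  sSup {k : ℕ | IsKConnected G k}

/-- For a nonempty finite graph the maximum in the definition of the connectivity is attained. -/
theorem isGreatest_vertexConnectivity {V : Type*} [Fintype V] [Nonempty V] (G : SimpleGraph V) :
    IsGreatest {k : ℕ | IsKConnected G k} (vertexConnectivity G) := by
  have hne : {k : ℕ | IsKConnected G k}.Nonempty :=
    ⟨0, Fintype.card_pos, fun X hX => absurd hX (Nat.not_lt_zero _)⟩
  have hbdd : BddAbove {k : ℕ | IsKConnected G k} :=
    ⟨Fintype.card V, fun k hk => hk.1.le⟩
  exact ⟨Nat.sSup_mem hne hbdd, fun k hk => le_csSup hbdd hk⟩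

end GraphConnectivity

section FiberGraph

/-- The `n × n` matrices of nonnegative integers all of whose row sums and column sums are `r`. -/
def EqualSumTable (n r : ℕ) : Type :=
  {A : Matrix (Fin n) (Fin n) ℕ // (∀ i, ∑ j, A i j = r) ∧ (∀ j, ∑ i, A i j = r)}

/-- There are finitely many such matrices, since every entry is at most `r`. -/
instance EqualSumTable.instFinite (n r : ℕ) : Finite (EqualSumTable n r) := by
  have hle : ∀ (A : EqualSumTable n r) (i j : Fin n), A.1 i j < r + 1 := fun A i j =>
    Nat.lt_succ_of_le <|
      (Finset.single_le_sum (f := fun j => A.1 i j) (fun _ _ => Nat.zero_le _)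
        (Finset.mem_univ j)).trans (A.2.1 i).le
  refine Finite.of_injective
    (fun A : EqualSumTable n r => fun i j => (⟨A.1 i j, hle A i j⟩ : Fin (r + 1))) ?_
  intro A B h
  refine Subtype.ext (Matrix.ext fun i j => ?_)
  exact congrArg Fin.val (congrFun (congrFun h i) j)

noncomputable instance EqualSumTable.instFintype (n r : ℕ) : Fintype (EqualSumTable n r) :=
  Fintype.ofFinite _

/-- The multiple `r • I` of the identity matrix shows that such matrices exist. -/
instance EqualSumTable.instNonempty (n r : ℕ) : Nonempty (EqualSumTable n r) :=
  ⟨⟨fun i j => if i = j then r else 0, by simp, by simp⟩⟩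

/-- The Markov moves for `n × n` tables: the matrices `±(e_ij + e_kl - e_il - e_kj)` with
`i < k` and `j < l`, where `e_ij` is the matrix with a one in position `(i, j)` and zeros
elsewhere. -/
def markovMoves (n : ℕ) : Set (Matrix (Fin n) (Fin n) ℤ) :=
  {b | ∃ i k j l : Fin n, i < k ∧ j < l ∧
    (b = Matrix.single i j 1 + Matrix.single k l 1 - Matrix.single i l 1 - Matrix.single k j 1 ∨
      b = -(Matrix.single i j 1 + Matrix.single k l 1
        - Matrix.single i l 1 - Matrix.single k j 1))}

theorem neg_mem_markovMoves {n : ℕ} {b : Matrix (Fin n) (Fin n) ℤ} (hb : b ∈ markovMoves n) :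
    -b ∈ markovMoves n := by
  obtain ⟨i, k, j, l, hik, hjl, h | h⟩ := hb
  · exact ⟨i, k, j, l, hik, hjl, Or.inr (by rw [h])⟩
  · exact ⟨i, k, j, l, hik, hjl, Or.inl (by rw [h, neg_neg])⟩

theorem zero_notMem_markovMoves (n : ℕ) : (0 : Matrix (Fin n) (Fin n) ℤ) ∉ markovMoves n := by
  rintro ⟨i, k, j, l, hik, hjl, h | h⟩
  · have := congrFun (congrFun h i) j
    simp [hik.ne', hjl.ne'] at this
  · have := congrFun (congrFun h i) j
    simp [hik.ne', hjl.ne'] at this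

/-- The graph `G(n, r)`: its vertices are the `n × n` matrices of nonnegative integers with all
row and column sums equal to `r`, and two vertices are adjacent when their difference is a
Markov move. -/
def fiberGraph (n r : ℕ) : SimpleGraph (EqualSumTable n r) where
  Adj u v := v.1.map (Nat.cast : ℕ → ℤ) - u.1.map (Nat.cast : ℕ → ℤ) ∈ markovMoves n
  symm := ⟨fun u v h => by
    have h' := neg_mem_markovMoves h
    rwa [neg_sub] at h'⟩
  loopless := ⟨fun u h => zero_notMem_markovMoves n (by rwa [sub_self] at h)⟩

noncomputable instance fiberGraph.instDecidableRelAdj (n r : ℕ) :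
    DecidableRel (fiberGraph n r).Adj :=
  Classical.decRel _

end FiberGraph

/-! The table `r • I` has positive entries only on its diagonal, so its degree is at most `n.choose
2`. Deleting all neighbours of a vertex isolates it, which bounds the connectivity from above.

For the lower bound, `reachableOff_of_neighbors` reduces the claim to a local one: after deleting a
set `X` of fewer than `n.choose 2` vertices, any two surviving neighbours of a deleted `x` are still
joined. By Hall's theorem `x` dominates a sum of three permutation matrices, because `r ≥ 3`. Each
permutation `σ` offers `n.choose 2` moves at `x`, which also gives the lower bound on degrees.

A move spoils at most two of the three permutations, so every neighbour `a = x + m` still dominates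
one of them, say `σ`. The paths `x + m, x + m + p, x + p`, with `p` along `σ`, are too many for `X`
to block (`exists_reachableOff_permMoves`). Two neighbours `x + m`, `x + m'` along one permutation
are joined by paths `x + m, x + m + p, x + p, x + m' + p, x + m'`, with `p` along another
(`reachableOff_of_permMoves`). These paths may collide or run through `x`; each exceptional `p` is
paid for by a separate vertex known to lie in `X`. -/

section LocalConnectivity

/-! ### Connectivity after deleting vertices -/

variable {V : Type*} {G : SimpleGraph V} {X : Finset V} {u v w : V}

/-- `v` can be reached from `u` by a walk in `G` all of whose steps avoid `X`. -/
def ReachableOff (G : SimpleGraph V) (X : Finset V) : V → V → Prop :=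
  Relation.ReflTransGen fun u v => G.Adj u v ∧ u ∉ X ∧ v ∉ X

theorem ReachableOff.symm (h : ReachableOff G X u v) : ReachableOff G X v u :=
  have : Std.Symm fun u v => G.Adj u v ∧ u ∉ X ∧ v ∉ X := ⟨fun _ _ h => ⟨h.1.symm, h.2.2, h.2.1⟩⟩
  Relation.ReflTransGen.stdSymm.symm _ _ h

theorem ReachableOff.trans (h : ReachableOff G X u v) (h' : ReachableOff G X v w) :
    ReachableOff G X u w :=
  Relation.ReflTransGen.trans h h'

theorem ReachableOff.of_adj (h : G.Adj u v) (hu : u ∉ X) (hv : v ∉ X) : ReachableOff G X u v :=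
  Relation.ReflTransGen.single ⟨h, hu, hv⟩

theorem ReachableOff.reachable_induce (h : ReachableOff G X u v) (hu : u ∉ X) :
    ∃ hv : v ∉ X, (G.induce {v : V | v ∉ X}).Reachable ⟨u, hu⟩ ⟨v, hv⟩ := by
  induction h with
  | refl => exact ⟨hu, SimpleGraph.Reachable.refl _⟩
  | tail _ hbc ih =>
    obtain ⟨hb, hr⟩ := ih
    refine ⟨hbc.2.2, hr.trans (SimpleGraph.Adj.reachable ?_)⟩
    exact hbc.1

/-- A connected graph in which any two neighbours of a removed vertex remain joined after the
removal of fewer than `N` vertices stays connected after every such removal. -/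
theorem reachableOff_of_neighbors {N : ℕ} (hG : ∀ u v, ReachableOff G ∅ u v)
    (hN : ∀ X : Finset V, X.card < N → ∀ x ∈ X, ∀ a b, a ∉ X → b ∉ X → G.Adj x a → G.Adj x b →
      ReachableOff G X a b) (X : Finset V) :
    X.card < N → ∀ a b, a ∉ X → b ∉ X → ReachableOff G X a b := by
  classical
  induction X using Finset.induction with
  | empty => exact fun _ a b _ _ => hG a b
  | insert x X hx ih =>
    intro hcard a b ha hb
    have hcard' : X.card < N := lt_of_le_of_lt (Finset.card_le_card (Finset.subset_insert x X)) hcard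
    have hab := ih hcard' a b (fun h => ha (Finset.mem_insert_of_mem h))
      (fun h => hb (Finset.mem_insert_of_mem h))
    -- A walk avoiding `X` may visit `x`, where it is rerouted between the neighbours before and
    -- after. The second conjunct carries the induction through a visit to `x`.
    have key : (a ≠ x → ReachableOff G (insert x X) a b) ∧
        (a = x → ∀ c, c ∉ insert x X → G.Adj x c → ReachableOff G (insert x X) c b) := by
      clear ha
      induction hab using Relation.ReflTransGen.head_induction_on with
      | refl =>
        refine ⟨fun _ => Relation.ReflTransGen.refl, fun h => ?_⟩
        exact absurd (h ▸ Finset.mem_insert_self x X) hb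
      | @head p q hac _ ihc =>
        obtain ⟨hpq, hp, hq⟩ := hac
        refine ⟨fun hpx => ?_, fun hpx c hc hxc => ?_⟩
        · have hp' : p ∉ insert x X := by simp [hpx, hp]
          by_cases hqx : q = x
          · exact ihc.2 hqx p hp' (hqx ▸ hpq.symm)
          · exact (ReachableOff.of_adj hpq hp' (by simp [hqx, hq])).trans (ihc.1 hqx)
        · subst hpx
          have hqx : q ≠ p := hpq.ne'
          exact (hN _ hcard p (Finset.mem_insert_self _ _) c q hc (by simp [hqx, hq]) hxc hpq).trans
            (ihc.1 hqx)
    exact key.1 (fun h => ha (h ▸ Finset.mem_insert_self x X))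

/-- Deleting the neighbours of `v` isolates it, and if its degree were below `k`, the bound `k <
|V|` would leave another vertex. -/
theorem IsKConnected.le_degree [Fintype V] [DecidableRel G.Adj] {k : ℕ} (h : IsKConnected G k)
    (v : V) : k ≤ G.degree v := by
  classical
  by_contra! hlt
  have hcard : (insert v (G.neighborFinset v)).card < Fintype.card V := by
    have := Finset.card_insert_le v (G.neighborFinset v)
    rw [G.card_neighborFinset_eq_degree] at this
    have := h.1
    omega
  obtain ⟨w, hw⟩ : ∃ w, w ∉ insert v (G.neighborFinset v) := by
    by_contra! hall
    rw [Finset.eq_univ_iff_forall.2 hall, Finset.card_univ] at hcard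
    exact lt_irrefl _ hcard
  have hv : v ∉ G.neighborFinset v := by simp
  have hw' : w ∉ G.neighborFinset v := fun h => hw (Finset.mem_insert_of_mem h)
  have hwv : w ≠ v := fun h => hw (h ▸ Finset.mem_insert_self _ _)
  have hconn := h.2 (G.neighborFinset v) (by rwa [G.card_neighborFinset_eq_degree])
  obtain ⟨p⟩ := hconn.preconnected ⟨v, hv⟩ ⟨w, hw'⟩
  cases p with
  | nil => exact hwv rfl
  | @cons _ c _ hadj _ =>
    exact c.2 ((G.mem_neighborFinset v c.1).2 hadj)

end LocalConnectivity

/-- Counting with exceptions: `R` indexes paths blocked by `X`, and the reserved vertices `Y` pay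
for the indices `B` on which `f` is not controlled. -/
theorem card_le_card_of_injOn_sdiff {α β : Type*} [DecidableEq α] [DecidableEq β] {R B : Finset α}
    {X Y : Finset β} (f : α → β) (hY : Y ⊆ X) (hcard : B.card ≤ Y.card)
    (hf : ∀ n ∈ R \ B, f n ∈ X \ Y) (hinj : Set.InjOn f (R \ B : Finset α)) :
    R.card ≤ X.card := by
  have h1 := Finset.card_le_card_of_injOn f hf hinj
  have h2 := Finset.card_sdiff_add_card_eq_card hY
  have h3 := Finset.le_card_sdiff B R
  omega

/-! ### Permutation matrices below a matrix with equal line sums -/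

section RegularMatrix

variable {n : ℕ}

/-- Hall's condition for the support holds by double counting: the rows in `S` carry weight `|S| *
s`, all inside the columns they meet. -/
theorem exists_perm_pos_of_sum_eq {s : ℕ} (hs : 0 < s) (A : Matrix (Fin n) (Fin n) ℕ)
    (hr : ∀ i, ∑ j, A i j = s) (hc : ∀ j, ∑ i, A i j = s) :
    ∃ σ : Equiv.Perm (Fin n), ∀ i, 0 < A i (σ i) := by
  let f (i : Fin n) : Finset (Fin n) := {j | A i j ≠ 0}
  have hf (S : Finset (Fin n)) : S.card ≤ (S.biUnion f).card := by
    have h0 (i) : ∑ j ∈ f i, A i j = s := by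
      rw [← hr i]; exact Finset.sum_filter_ne_zero _
    have h₁ : ∑ i ∈ S, ∑ j ∈ f i, A i j = S.card * s := by simp [h0]
    have h₂ : ∑ i, ∑ j ∈ S.biUnion f, A i j = (S.biUnion f).card * s := by
      exact Finset.sum_comm.trans (by simp [hc])
    refine Nat.le_of_mul_le_mul_right ?_ hs
    rw [← h₁, ← h₂]
    calc _ ≤ ∑ i ∈ S, ∑ j ∈ S.biUnion f, A i j := Finset.sum_le_sum fun i hi =>
          Finset.sum_le_sum_of_subset (Finset.subset_biUnion_of_mem f hi)
      _ ≤ _ := Finset.sum_le_sum_of_subset (Finset.subset_univ _)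
  obtain ⟨g, hg, hg'⟩ := (Finset.all_card_le_biUnion_card_iff_exists_injective f).1 hf
  refine ⟨Equiv.ofBijective g (Finite.injective_iff_bijective.1 hg), fun i => ?_⟩
  simpa [f, Nat.pos_iff_ne_zero] using hg' i

/-- A matrix of nonnegative integers with all row and column sums equal to `s + 1` is a
permutation matrix plus a matrix with all row and column sums equal to `s`. -/
theorem exists_perm_add_of_sum_eq {s : ℕ} (A : Matrix (Fin n) (Fin n) ℕ)
    (hr : ∀ i, ∑ j, A i j = s + 1) (hc : ∀ j, ∑ i, A i j = s + 1) :
    ∃ (σ : Equiv.Perm (Fin n)) (A' : Matrix (Fin n) (Fin n) ℕ),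
      (∀ i j, A i j = A' i j + if σ i = j then 1 else 0) ∧
      (∀ i, ∑ j, A' i j = s) ∧ (∀ j, ∑ i, A' i j = s) := by
  obtain ⟨σ, hσ⟩ := exists_perm_pos_of_sum_eq s.succ_pos A hr hc
  have h : ∀ i j, A i j = (A i j - if σ i = j then 1 else 0) + if σ i = j then 1 else 0 := by
    intro i j
    split_ifs with hij
    · have := hσ i
      rw [hij] at this
      omega
    · simp
  refine ⟨σ, fun i j => A i j - if σ i = j then 1 else 0, h, fun i => ?_, fun j => ?_⟩
  · have := hr i
    rw [Finset.sum_congr rfl fun j _ => h i j, Finset.sum_add_distrib] at this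
    simpa using this
  · have := hc j
    rw [Finset.sum_congr rfl fun i _ => h i j, Finset.sum_add_distrib] at this
    simpa [← σ.eq_symm_apply] using this

theorem exists_three_perms_le {r : ℕ} (hr3 : 2 < r) (A : Matrix (Fin n) (Fin n) ℕ)
    (hr : ∀ i, ∑ j, A i j = r) (hc : ∀ j, ∑ i, A i j = r) :
    ∃ σ τ ρ : Equiv.Perm (Fin n), ∀ i j,
      (if σ i = j then 1 else 0) + (if τ i = j then 1 else 0) + (if ρ i = j then 1 else 0)
        ≤ A i j := by
  obtain ⟨s, rfl⟩ : ∃ s, r = s + 1 + 1 + 1 := ⟨r - 3, by omega⟩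
  obtain ⟨σ, A', hA, hr', hc'⟩ := exists_perm_add_of_sum_eq A hr hc
  obtain ⟨τ, B, hB, hr'', hc''⟩ := exists_perm_add_of_sum_eq A' hr' hc'
  obtain ⟨ρ, C, hC, -, -⟩ := exists_perm_add_of_sum_eq B hr'' hc''
  refine ⟨σ, τ, ρ, fun i j => ?_⟩
  rw [hA, hB, hC]
  omega

end RegularMatrix

/-! ### Markov moves and the moves along a permutation -/

section Moves

variable {n : ℕ}

/-- The move that decreases the entries at `(i, j)` and `(k, l)` by one and increases the entries
at `(i, l)` and `(k, j)` by one. -/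
def swapMove (i k j l : Fin n) : Matrix (Fin n) (Fin n) ℤ := fun a b =>
  ((if a = k then 1 else 0) - if a = i then 1 else 0) *
    ((if b = j then 1 else 0) - if b = l then 1 else 0)

theorem swapMove_symm (i k j l : Fin n) : swapMove i k j l = swapMove k i l j := by
  ext a b
  simp only [swapMove]
  ring

theorem neg_swapMove (i k j l : Fin n) : -swapMove i k j l = swapMove i k l j := by
  ext a b
  simp only [swapMove, Matrix.neg_apply]
  ring

theorem swapMove_eq_single (i k j l : Fin n) :
    swapMove i k j l = -(Matrix.single i j 1 + Matrix.single k l 1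
        - Matrix.single i l 1 - Matrix.single k j 1) := by
  ext a b
  simp only [swapMove, Matrix.neg_apply, Matrix.sub_apply, Matrix.add_apply, Matrix.single_apply]
  split_ifs <;> grind

/-- Exchanging `j` and `l` negates a swap and exchanging both pairs fixes it, so merely distinct
indices absorb the sign and the orderings. -/
theorem mem_markovMoves_iff {D : Matrix (Fin n) (Fin n) ℤ} :
    D ∈ markovMoves n ↔ ∃ i k j l, i ≠ k ∧ j ≠ l ∧ D = swapMove i k j l := by
  constructor
  · rintro ⟨i, k, j, l, hik, hjl, h | h⟩
    · refine ⟨i, k, l, j, hik.ne, hjl.ne', ?_⟩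
      rw [h, ← neg_swapMove, swapMove_eq_single, neg_neg]
    · exact ⟨i, k, j, l, hik.ne, hjl.ne, by rw [h, swapMove_eq_single]⟩
  · rintro ⟨i, k, j, l, hik, hjl, rfl⟩
    rcases lt_or_gt_of_ne hik with hik | hik <;> rcases lt_or_gt_of_ne hjl with hjl | hjl
    · exact ⟨i, k, j, l, hik, hjl, Or.inr (swapMove_eq_single _ _ _ _)⟩
    · exact ⟨i, k, l, j, hik, hjl, Or.inl (by rw [← neg_swapMove, swapMove_eq_single, neg_neg])⟩
    · exact ⟨k, i, j, l, hik, hjl,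
        Or.inl (by rw [swapMove_symm, ← neg_swapMove, swapMove_eq_single, neg_neg])⟩
    · exact ⟨k, i, l, j, hik, hjl, Or.inr (by rw [swapMove_symm, swapMove_eq_single])⟩

theorem swapMove_pos_iff {i k j l : Fin n} (hik : i ≠ k) (hjl : j ≠ l) (a b : Fin n) :
    0 < swapMove i k j l a b ↔ (a = k ∧ b = j) ∨ (a = i ∧ b = l) := by
  simp only [swapMove]
  split_ifs <;> grind

theorem swapMove_lower (i k j l a b : Fin n) :
    -((if a = i ∧ b = j then 1 else 0) + if a = k ∧ b = l then 1 else 0) ≤ swapMove i k j l a b := by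
  simp only [swapMove]
  split_ifs <;> grind

theorem sum_row_swapMove (i k j l a : Fin n) : ∑ b, swapMove i k j l a b = 0 := by
  simp [swapMove, ← Finset.mul_sum]

theorem sum_col_swapMove (i k j l b : Fin n) : ∑ a, swapMove i k j l a b = 0 := by
  simp [swapMove, ← Finset.sum_mul]

theorem eq_swapMove_of_pos {m : Matrix (Fin n) (Fin n) ℤ} (hm : m ∈ markovMoves n)
    {i k j l : Fin n} (hik : i ≠ k) (h1 : 0 < m i l) (h2 : 0 < m k j) : m = swapMove i k j l := by
  obtain ⟨a, c, b, d, hac, hbd, rfl⟩ := mem_markovMoves_iff.1 hm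
  rw [swapMove_pos_iff hac hbd] at h1 h2
  rcases h1 with ⟨rfl, rfl⟩ | ⟨rfl, rfl⟩ <;> rcases h2 with ⟨rfl, rfl⟩ | ⟨rfl, rfl⟩
  · exact absurd rfl hik
  · exact swapMove_symm _ _ _ _
  · rfl
  · exact absurd rfl hik

/-- The moves that decrease two entries of the permutation matrix of `σ`. -/
def permMoves (σ : Equiv.Perm (Fin n)) : Finset (Matrix (Fin n) (Fin n) ℤ) :=
  (Finset.univ.filter fun p : Fin n × Fin n => p.1 < p.2).image
    fun p => swapMove p.1 p.2 (σ p.1) (σ p.2)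

variable {σ : Equiv.Perm (Fin n)} {m m' p p' : Matrix (Fin n) (Fin n) ℤ}

theorem mem_permMoves_iff :
    m ∈ permMoves σ ↔ ∃ i k, i ≠ k ∧ m = swapMove i k (σ i) (σ k) := by
  simp only [permMoves, Finset.mem_image, Finset.mem_filter, Finset.mem_univ, true_and,
    Prod.exists]
  constructor
  · rintro ⟨i, k, hik, rfl⟩
    exact ⟨i, k, hik.ne, rfl⟩
  · rintro ⟨i, k, hik, rfl⟩
    rcases lt_or_gt_of_ne hik with hik | hik
    · exact ⟨i, k, hik, rfl⟩
    · exact ⟨k, i, hik, swapMove_symm _ _ _ _⟩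

theorem card_permMoves (σ : Equiv.Perm (Fin n)) : (permMoves σ).card = n.choose 2 := by
  rw [permMoves, Finset.card_image_of_injOn]
  · have h : (Finset.univ.filter fun p : Fin n × Fin n => p.1 < p.2).card =
        ∑ k : Fin n, (k : ℕ) := by
      rw [Finset.card_eq_sum_card_fiberwise (f := Prod.snd) (t := Finset.univ) (by simp)]
      refine Finset.sum_congr rfl fun k _ => ?_
      rw [← Fin.card_Iio k]
      refine Finset.card_bij' (fun p _ => p.1) (fun i _ => (i, k)) ?_ ?_ ?_ ?_ <;>
        grind
    rw [h, Fin.sum_univ_eq_sum_range (fun k => k), Finset.sum_range_id, Nat.choose_two_right]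
  · rintro ⟨i, k⟩ hik ⟨j, l⟩ hjl h
    simp only [Finset.coe_filter, Finset.mem_univ, true_and, Set.mem_ofPred_eq] at hik hjl h
    have h1 := (swapMove_pos_iff hik.ne (σ.injective.ne hik.ne) i (σ k)).2 (Or.inr ⟨rfl, rfl⟩)
    rw [h, swapMove_pos_iff hjl.ne (σ.injective.ne hjl.ne)] at h1
    rcases h1 with ⟨rfl, h1⟩ | ⟨rfl, h1⟩
    · cases σ.injective h1
      exact absurd hik hjl.asymm
    · cases σ.injective h1
      rfl

theorem permMoves_subset_markovMoves (h : m ∈ permMoves σ) : m ∈ markovMoves n := by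
  obtain ⟨i, k, hik, rfl⟩ := mem_permMoves_iff.1 h
  exact mem_markovMoves_iff.2 ⟨i, k, _, _, hik, σ.injective.ne hik, rfl⟩

theorem ne_zero_of_mem_markovMoves (h : m ∈ markovMoves n) : m ≠ 0 := by
  rintro rfl
  exact zero_notMem_markovMoves n h

theorem permMoves_lower (h : m ∈ permMoves σ) (a b : Fin n) :
    -(if σ a = b then 1 else 0) ≤ m a b := by
  obtain ⟨i, k, hik, rfl⟩ := mem_permMoves_iff.1 h
  have h1 := swapMove_lower i k (σ i) (σ k) a b
  refine le_trans (neg_le_neg ?_) h1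
  split_ifs <;> grind

theorem exists_eq_swapMove_of_neg (h : m ∈ permMoves σ) {i : Fin n} (hi : m i (σ i) < 0) :
    ∃ k, i ≠ k ∧ m = swapMove i k (σ i) (σ k) := by
  obtain ⟨j, l, hjl, rfl⟩ := mem_permMoves_iff.1 h
  rcases eq_or_ne i j with rfl | hij
  · exact ⟨l, hjl, rfl⟩
  rcases eq_or_ne i l with rfl | hil
  · exact ⟨j, hjl.symm, swapMove_symm _ _ _ _⟩
  · simp [swapMove, hij, hil] at hi

theorem permMoves_eq_of_pos (h : m ∈ permMoves σ) (h' : m' ∈ permMoves σ) {a b : Fin n}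
    (hm : 0 < m a b) (hm' : 0 < m' a b) : m = m' := by
  obtain ⟨i, k, hik, rfl⟩ := mem_permMoves_iff.1 h
  obtain ⟨j, l, hjl, rfl⟩ := mem_permMoves_iff.1 h'
  rw [swapMove_pos_iff hik (σ.injective.ne hik)] at hm
  rw [swapMove_pos_iff hjl (σ.injective.ne hjl)] at hm'
  rcases hm with ⟨rfl, rfl⟩ | ⟨rfl, rfl⟩ <;> rcases hm' with ⟨rfl, h1⟩ | ⟨rfl, h1⟩ <;>
    cases σ.injective h1
  · rfl
  · exact swapMove_symm _ _ _ _
  · exact swapMove_symm _ _ _ _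
  · rfl

/-- A move along `σ` is recovered from the two entries that it increases. -/
theorem exists_cells_of_mem_permMoves (h : m ∈ permMoves σ) : ∃ i k, i ≠ k ∧
    m i (σ k) = 1 ∧ m k (σ i) = 1 ∧
    (∀ q ∈ markovMoves n, 0 < q i (σ k) → 0 < q k (σ i) → q = m) ∧
    ∀ q ∈ permMoves σ, q ≠ m → q i (σ k) = 0 ∧ q k (σ i) = 0 := by
  obtain ⟨i, k, hik, hm⟩ := mem_permMoves_iff.1 h
  have hne := σ.injective.ne hik
  have h1 : m i (σ k) = 1 := by rw [hm]; simp [swapMove, hik, hne.symm]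
  have h2 : m k (σ i) = 1 := by rw [hm]; simp [swapMove, hik.symm, hne]
  refine ⟨i, k, hik, h1, h2, fun q hq h3 h4 => hm ▸ eq_swapMove_of_pos hq hik h3 h4,
    fun q hq hqm => ⟨le_antisymm ?_ ?_, le_antisymm ?_ ?_⟩⟩
  · by_contra! hpos
    exact hqm (permMoves_eq_of_pos hq h hpos (by omega))
  · simpa [hne] using permMoves_lower hq i (σ k)
  · by_contra! hpos
    exact hqm (permMoves_eq_of_pos hq h hpos (by omega))
  · simpa [hne.symm] using permMoves_lower hq k (σ i)

/-- This linear invariant shows that the negative of a move along `σ` is never along `σ`. -/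
theorem sum_permMoves (h : m ∈ permMoves σ) : ∑ a, m a (σ a) = -2 := by
  obtain ⟨i, k, hik, rfl⟩ := mem_permMoves_iff.1 h
  have hne := σ.injective.ne hik
  have : ∀ a, swapMove i k (σ i) (σ k) a (σ a) =
      -((if a = i then 1 else 0) + if a = k then 1 else 0) := by
    intro a
    simp only [swapMove, σ.injective.eq_iff]
    split_ifs <;> grind
  simp [this, Finset.sum_add_distrib]

theorem permMoves_add_ne_zero (h : m ∈ permMoves σ) (h' : m' ∈ permMoves σ) : m + m' ≠ 0 := by
  intro h0
  have h1 : ∑ a, (m + m') a (σ a) = -4 := by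
    simp [Finset.sum_add_distrib, sum_permMoves h, sum_permMoves h']
  rw [h0] at h1
  simp at h1

/-- Distinct moves along a permutation never differ by a single move. -/
theorem markovMoves_add_permMoves_ne (hm : m ∈ markovMoves n) (hp : p ∈ permMoves σ)
    (hp' : p' ∈ permMoves σ) : m + p ≠ p' := by
  intro h
  have hm0 := ne_zero_of_mem_markovMoves hm
  have hpp : p ≠ p' := fun h' => hm0 (by simpa [h'] using h)
  -- On the two cells raised by `p'` the move `p` vanishes, so `m` raises both and equals `p'`,
  -- forcing `p = 0`.
  obtain ⟨i, k, -, h1, h2, h3, h4⟩ := exists_cells_of_mem_permMoves hp'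
  obtain ⟨h5, h6⟩ := h4 p hp hpp
  have e1 := congrFun (congrFun h i) (σ k)
  have e2 := congrFun (congrFun h k) (σ i)
  rw [Matrix.add_apply] at e1 e2
  have := h3 m hm (by omega) (by omega)
  rw [this] at h
  exact ne_zero_of_mem_markovMoves (permMoves_subset_markovMoves hp) (by simpa using h)

/-- A cell raised by `p` is untouched by every other move along `σ`, so only `q = p` can produce the
entry 1 there. Hence collisions between two families of paths involve at most one pair of distinct
moves. -/
theorem permMoves_eq_of_sub_eq {q q' : Matrix (Fin n) (Fin n) ℤ} (hp : p ∈ permMoves σ)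
    (hp' : p' ∈ permMoves σ) (hq : q ∈ permMoves σ) (hq' : q' ∈ permMoves σ) (hne : p ≠ p')
    (h : p - p' = q - q') : p = q ∧ p' = q' := by
  obtain ⟨i, k, -, h1, -, -, h4⟩ := exists_cells_of_mem_permMoves hp
  have e := congrFun (congrFun h i) (σ k)
  have h5 := (h4 p' hp' hne.symm).1
  have hpq : p = q := by
    by_contra hpq
    have h6 := (h4 q hq (Ne.symm hpq)).1
    by_cases hpq' : q' = p
    · subst hpq'
      simp only [Matrix.sub_apply] at e
      omega
    · have h7 := (h4 q' hq' hpq').1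
      simp only [Matrix.sub_apply] at e
      omega
  exact ⟨hpq, by simpa [hpq] using h⟩

/-- If `p ≠ -m`, then `-m` and `p'` vanish on the cells raised by `p`, so `m' = p` and `m = p'`.
Then `m` and `-m` are both along `σ`, which is impossible. -/
theorem add_eq_zero_of_neg_mem_permMoves (hm : -m ∈ permMoves σ) (hm' : m' ∈ markovMoves n)
    (hp : p ∈ permMoves σ) (hp' : p' ∈ permMoves σ) (hne : p ≠ p') (h : m + p = m' + p') :
    m + p = 0 := by
  by_contra h0
  have hpm : -m ≠ p := fun h' => h0 (by rw [← h']; simp)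
  obtain ⟨i, k, -, h1, h2, h3, h4⟩ := exists_cells_of_mem_permMoves hp
  have e1 := congrFun (congrFun h i) (σ k)
  have e2 := congrFun (congrFun h k) (σ i)
  have f1 := h4 _ hm hpm
  have f2 := h4 _ hp' hne.symm
  simp only [Matrix.add_apply, Matrix.neg_apply] at e1 e2 f1
  have := h3 m' hm' (by omega) (by omega)
  subst this
  have hmp : m = p' := by
    rw [add_comm m' p'] at h
    exact add_right_cancel h
  exact permMoves_add_ne_zero hm hp' (by rw [← hmp]; simp)

end Moves

/-! ### Tables and the moves available at them -/

section Tables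

variable {n r : ℕ}

/-- The entries of a table as integers. -/
def EqualSumTable.toInt (x : EqualSumTable n r) : Matrix (Fin n) (Fin n) ℤ :=
  x.1.map Nat.cast

theorem EqualSumTable.toInt_apply (x : EqualSumTable n r) (i j : Fin n) :
    x.toInt i j = (x.1 i j : ℤ) :=
  rfl

theorem EqualSumTable.toInt_injective :
    Function.Injective (EqualSumTable.toInt : EqualSumTable n r → _) := by
  intro x y h
  refine Subtype.ext (Matrix.ext fun i j => ?_)
  have := congrFun (congrFun h i) j
  simpa [EqualSumTable.toInt_apply] using this

theorem fiberGraph_adj_iff {x y : EqualSumTable n r} :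
    (fiberGraph n r).Adj x y ↔ y.toInt - x.toInt ∈ markovMoves n :=
  Iff.rfl

theorem fiberGraph_adj_of_eq_add {x y : EqualSumTable n r} {m : Matrix (Fin n) (Fin n) ℤ}
    (hm : m ∈ markovMoves n) (h : y.toInt = x.toInt + m) : (fiberGraph n r).Adj x y := by
  rw [fiberGraph_adj_iff, h, add_sub_cancel_left]
  exact hm

theorem exists_toInt_eq_add (x : EqualSumTable n r) {m : Matrix (Fin n) (Fin n) ℤ}
    (hm : m ∈ markovMoves n) (h : ∀ i j, 0 ≤ x.toInt i j + m i j) :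
    ∃ y : EqualSumTable n r, y.toInt = x.toInt + m := by
  have hcast : ∀ i j, (((x.toInt i j + m i j).toNat : ℕ) : ℤ) = x.1 i j + m i j := fun i j =>
    Int.toNat_of_nonneg (h i j)
  have hrow : ∀ i, ∑ j, m i j = 0 := by
    obtain ⟨i, k, j, l, -, -, rfl⟩ := mem_markovMoves_iff.1 hm
    exact sum_row_swapMove i k j l
  have hcol : ∀ j, ∑ i, m i j = 0 := by
    obtain ⟨i, k, j, l, -, -, rfl⟩ := mem_markovMoves_iff.1 hm
    exact sum_col_swapMove i k j l
  refine ⟨⟨fun i j => (x.toInt i j + m i j).toNat, fun i => ?_, fun j => ?_⟩, ?_⟩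
  · zify
    rw [Finset.sum_congr rfl fun j _ => hcast i j, Finset.sum_add_distrib, hrow, add_zero]
    exact_mod_cast x.2.1 i
  · zify
    rw [Finset.sum_congr rfl fun i _ => hcast i j, Finset.sum_add_distrib, hcol, add_zero]
    exact_mod_cast x.2.2 j
  · ext i j
    exact hcast i j

/-! ### Joining neighbours of a deleted vertex -/

variable {σ ρ : Equiv.Perm (Fin n)} {X : Finset (EqualSumTable n r)}

theorem exists_toInt_eq_add_permMove {x : EqualSumTable n r} (hσ : ∀ i, 0 < x.1 i (σ i))
    {p : Matrix (Fin n) (Fin n) ℤ} (hp : p ∈ permMoves σ) :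
    ∃ y : EqualSumTable n r, y.toInt = x.toInt + p := by
  refine exists_toInt_eq_add x (permMoves_subset_markovMoves hp) fun i j => ?_
  have h1 := permMoves_lower hp i j
  rw [EqualSumTable.toInt_apply]
  split_ifs at h1 with hij
  · have := hσ i
    rw [hij] at this
    omega
  · omega

/-- Off a set `X` of fewer than `n.choose 2` vertices, a neighbour of `x ∈ X` that dominates the
permutation matrix of `σ ≤ x` is joined to a neighbour of `x` along `σ`. -/
theorem exists_reachableOff_permMoves (hX : X.card < n.choose 2) {x a : EqualSumTable n r}
    (hx : x ∈ X) (ha : a ∉ X) (hxa : (fiberGraph n r).Adj x a) (hσx : ∀ i, 0 < x.1 i (σ i))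
    (hσa : ∀ i, 0 < a.1 i (σ i)) :
    ∃ c, c ∉ X ∧ c.toInt - x.toInt ∈ permMoves σ ∧ ReachableOff (fiberGraph n r) X a c := by
  classical
  obtain ⟨m, hm⟩ : ∃ m, m = a.toInt - x.toInt := ⟨_, rfl⟩
  have hmm : m ∈ markovMoves n := hm ▸ fiberGraph_adj_iff.1 hxa
  have hax : a.toInt = x.toInt + m := by rw [hm]; abel
  by_contra! hno
  -- Each path `a, a + p, x + p` is blocked by a vertex of `X` other than `x`. The excluded `p = -m`
  -- would return to `x`, and `x` itself pays for it.
  have hg : ∀ p ∈ permMoves σ \ {-m}, ∃ y ∈ X \ {x},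
      y.toInt = x.toInt + (m + p) ∨ y.toInt = x.toInt + p := by
    intro p hp
    rw [Finset.mem_sdiff, Finset.mem_singleton] at hp
    obtain ⟨hp, hpm⟩ := hp
    have hpM := permMoves_subset_markovMoves hp
    obtain ⟨c, hc⟩ := exists_toInt_eq_add_permMove hσa hp
    obtain ⟨d, hd⟩ := exists_toInt_eq_add_permMove hσx hp
    have hcx : c ≠ x := by
      rintro rfl
      rw [hax, add_assoc, left_eq_add] at hc
      exact hpm (eq_neg_of_add_eq_zero_right hc)
    have hdx : d ≠ x := by
      rintro rfl
      exact ne_zero_of_mem_markovMoves hpM (by simpa using hd)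
    by_cases hcX : c ∈ X
    · exact ⟨c, by simp [hcX, hcx], Or.inl (by rw [hc, hax, add_assoc])⟩
    by_cases hdX : d ∈ X
    · exact ⟨d, by simp [hdX, hdx], Or.inr hd⟩
    have hac := fiberGraph_adj_of_eq_add hpM hc
    have hdc : (fiberGraph n r).Adj d c :=
      fiberGraph_adj_of_eq_add hmm (by rw [hc, hd, hax]; abel)
    exact absurd ((ReachableOff.of_adj hac ha hcX).trans (ReachableOff.of_adj hdc.symm hcX hdX))
      (hno d hdX (by rw [hd, add_sub_cancel_left]; exact hp))
  choose! g hgX hg using hg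
  refine absurd (card_le_card_of_injOn_sdiff (R := permMoves σ) (B := {-m}) (X := X) (Y := {x}) g
    (by simpa using hx) (by simp) hgX ?_) (by rw [card_permMoves]; omega)
  intro p hp q hq hpq
  have h1 := hg p hp
  have h2 := hg q hq
  rw [hpq] at h1
  simp only [Finset.coe_sdiff, Set.mem_sdiff, Finset.mem_coe] at hp hq
  rcases h1 with h1 | h1 <;> rcases h2 with h2 | h2 <;> rw [h1, add_right_inj] at h2
  · exact add_left_cancel h2
  · exact absurd h2 (markovMoves_add_permMoves_ne hmm hp.1 hq.1)
  · exact absurd h2.symm (markovMoves_add_permMoves_ne hmm hq.1 hp.1)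
  · exact h2

/-- The move `m'` along `σ` can still be made after `m` if both are undone by moves along one and
the same permutation `ρ`. -/
theorem exists_toInt_eq_add_add {x : EqualSumTable n r} {m m' : Matrix (Fin n) (Fin n) ℤ}
    (hσx : ∀ i, 0 < x.1 i (σ i)) (hm : m ∈ permMoves σ) (hm' : m' ∈ permMoves σ)
    (hne : m ≠ m') (hρ : -m ∈ permMoves ρ) (hρ' : -m' ∈ permMoves ρ) :
    ∃ y : EqualSumTable n r, y.toInt = x.toInt + (m + m') := by
  obtain ⟨c, hc⟩ := exists_toInt_eq_add_permMove hσx hm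
  suffices ∀ i j, 0 ≤ c.toInt i j + m' i j by
    obtain ⟨y, hy⟩ := exists_toInt_eq_add c (permMoves_subset_markovMoves hm') this
    exact ⟨y, by rw [hy, hc, add_assoc]⟩
  -- Only a cell lowered by both moves could become negative. The other row `k` of such a move
  -- satisfies `ρ i = σ k`, so the two moves would coincide.
  have key : ∀ i, m i (σ i) < 0 → m' i (σ i) < 0 → False := by
    have hpartner : ∀ q ∈ permMoves σ, -q ∈ permMoves ρ → ∀ i, q i (σ i) < 0 →
        ∃ k, ρ i = σ k ∧ q = swapMove i k (σ i) (σ k) := by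
      intro q hq hqρ i hi
      obtain ⟨k, hik, rfl⟩ := exists_eq_swapMove_of_neg hq hi
      refine ⟨k, ?_, rfl⟩
      by_contra hne
      have h1 := permMoves_lower hqρ i (σ k)
      have h2 := (swapMove_pos_iff hik (σ.injective.ne hik) i (σ k)).2 (Or.inr ⟨rfl, rfl⟩)
      rw [if_neg hne, Matrix.neg_apply] at h1
      omega
    intro i hi hi'
    obtain ⟨k, hk, hmk⟩ := hpartner m hm hρ i hi
    obtain ⟨k', hk', hmk'⟩ := hpartner m' hm' hρ' i hi'
    cases σ.injective (hk.symm.trans hk')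
    exact hne (hmk.trans hmk'.symm)
  intro i j
  have h1 := permMoves_lower hm i j
  have h2 := permMoves_lower hm' i j
  have h0 : (0 : ℤ) ≤ c.toInt i j := by rw [EqualSumTable.toInt_apply]; omega
  have hcij := congrFun (congrFun hc i) j
  rw [Matrix.add_apply, EqualSumTable.toInt_apply x] at hcij
  split_ifs at h1 h2 with hij
  · subst hij
    have := hσx i
    by_contra! hlt
    exact key i (by omega) (by omega)
  · omega

/-- Off a set `X` of fewer than `n.choose 2` vertices, the neighbours of `x ∈ X` along `σ` are
joined to each other. -/
theorem reachableOff_of_permMoves (hX : X.card < n.choose 2) {x c c' : EqualSumTable n r}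
    (hx : x ∈ X) (hσρ : ∀ i j, (if σ i = j then 1 else 0) + (if ρ i = j then 1 else 0) ≤ x.1 i j)
    (hc : c ∉ X) (hc' : c' ∉ X) (hxc : c.toInt - x.toInt ∈ permMoves σ)
    (hxc' : c'.toInt - x.toInt ∈ permMoves σ) : ReachableOff (fiberGraph n r) X c c' := by
  classical
  obtain ⟨m, hm⟩ : ∃ m, m = c.toInt - x.toInt := ⟨_, rfl⟩
  obtain ⟨m', hm'⟩ : ∃ m', m' = c'.toInt - x.toInt := ⟨_, rfl⟩
  have hcx : c.toInt = x.toInt + m := by rw [hm]; abel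
  have hcx' : c'.toInt = x.toInt + m' := by rw [hm']; abel
  rw [← hm] at hxc
  rw [← hm'] at hxc'
  have hmM := permMoves_subset_markovMoves hxc
  have hmM' := permMoves_subset_markovMoves hxc'
  have hσx : ∀ i, 0 < x.1 i (σ i) := fun i => by
    have := hσρ i (σ i); rw [if_pos rfl] at this; omega
  have hρx : ∀ i, 0 < x.1 i (ρ i) := fun i => by
    have := hσρ i (ρ i); rw [if_pos rfl] at this; omega
  have hρ_of : ∀ (d : EqualSumTable n r) (q : Matrix (Fin n) (Fin n) ℤ), q ∈ permMoves σ →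
      d.toInt = x.toInt + q → ∀ i, 0 < d.1 i (ρ i) := by
    intro d q hq hd i
    have h1 := hσρ i (ρ i)
    have h2 := permMoves_lower hq i (ρ i)
    have h3 := congrFun (congrFun hd i) (ρ i)
    rw [Matrix.add_apply, EqualSumTable.toInt_apply, EqualSumTable.toInt_apply] at h3
    rw [if_pos (rfl : ρ i = ρ i)] at h1
    split_ifs at h1 h2 <;> omega
  have hρc := hρ_of c m hxc hcx
  have hρc' := hρ_of c' m' hxc' hcx'
  rcases eq_or_ne m m' with hmm | hmm
  · rw [EqualSumTable.toInt_injective (hcx.trans (hmm ▸ hcx'.symm))]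
    exact Relation.ReflTransGen.refl
  by_contra hno
  have hg : ∀ p ∈ permMoves ρ, ∃ y ∈ X,
      y.toInt = x.toInt + (m + p) ∨ y.toInt = x.toInt + p ∨ y.toInt = x.toInt + (m' + p) := by
    intro p hp
    have hpM := permMoves_subset_markovMoves hp
    obtain ⟨d, hd⟩ := exists_toInt_eq_add_permMove hρc hp
    obtain ⟨e, he⟩ := exists_toInt_eq_add_permMove hρx hp
    obtain ⟨d', hd'⟩ := exists_toInt_eq_add_permMove hρc' hp
    by_cases hdX : d ∈ X
    · exact ⟨d, hdX, Or.inl (by rw [hd, hcx, add_assoc])⟩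
    by_cases heX : e ∈ X
    · exact ⟨e, heX, Or.inr (Or.inl he)⟩
    by_cases hdX' : d' ∈ X
    · exact ⟨d', hdX', Or.inr (Or.inr (by rw [hd', hcx', add_assoc]))⟩
    have h1 := fiberGraph_adj_of_eq_add hpM hd
    have h2 : (fiberGraph n r).Adj e d :=
      fiberGraph_adj_of_eq_add hmM (by rw [hd, he, hcx]; abel)
    have h3 : (fiberGraph n r).Adj e d' :=
      fiberGraph_adj_of_eq_add hmM' (by rw [hd', he, hcx']; abel)
    have h4 := fiberGraph_adj_of_eq_add hpM hd'
    exact absurd ((ReachableOff.of_adj h1 hc hdX).trans <|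
      (ReachableOff.of_adj h2.symm hdX heX).trans <|
      (ReachableOff.of_adj h3 heX hdX').trans (ReachableOff.of_adj h4.symm hdX' hc')) hno
  choose! g hgX hg using hg
  -- the counting argument, once the exceptional moves `B` and vertices `Y` are known
  have count : ∀ (B : Finset (Matrix (Fin n) (Fin n) ℤ)) (Y : Finset (EqualSumTable n r)),
      Y ⊆ X → B.card ≤ Y.card → (∀ p ∈ permMoves ρ, p ∉ B → g p ∉ Y) →
      (∀ p ∈ permMoves ρ, ∀ q ∈ permMoves ρ, p ∉ B → q ∉ B → p ≠ q → m + p ≠ m' + q) →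
      False := by
    intro B Y hYX hBY hY hcol
    refine absurd (card_le_card_of_injOn_sdiff (R := permMoves ρ) (B := B) (X := X) (Y := Y) g
      hYX hBY (fun p hp => ?_) ?_) (by rw [card_permMoves]; omega)
    · rw [Finset.mem_sdiff] at hp
      exact Finset.mem_sdiff.2 ⟨hgX p hp.1, hY p hp.1 hp.2⟩
    · intro p hp q hq hpq
      simp only [Finset.coe_sdiff, Set.mem_sdiff, Finset.mem_coe] at hp hq
      by_contra hne
      have h1 := hg p hp.1
      have h2 := hg q hq.1
      rw [hpq] at h1
      rcases h1 with h1 | h1 | h1 <;> rcases h2 with h2 | h2 | h2 <;>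
        rw [h1, add_right_inj] at h2
      · exact hne (add_left_cancel h2)
      · exact markovMoves_add_permMoves_ne hmM hp.1 hq.1 h2
      · exact hcol p hp.1 q hq.1 hp.2 hq.2 hne h2
      · exact markovMoves_add_permMoves_ne hmM hq.1 hp.1 h2.symm
      · exact hne h2
      · exact markovMoves_add_permMoves_ne hmM' hq.1 hp.1 h2.symm
      · exact hcol q hq.1 p hp.1 hq.2 hp.2 (Ne.symm hne) h2.symm
      · exact markovMoves_add_permMoves_ne hmM' hp.1 hq.1 h2
      · exact hne (add_left_cancel h2)
  have hgx : ∀ p ∈ permMoves ρ, g p = x → p = -m ∨ p = -m' := by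
    intro p hp hpx
    have h1 := hg p hp
    rw [hpx] at h1
    simp only [left_eq_add] at h1
    rcases h1 with h1 | h1 | h1
    · exact Or.inl (eq_neg_of_add_eq_zero_right h1)
    · exact absurd h1 (ne_zero_of_mem_markovMoves (permMoves_subset_markovMoves hp))
    · exact Or.inr (eq_neg_of_add_eq_zero_right h1)
  have hpath : ∀ y : EqualSumTable n r, y ∉ X → (fiberGraph n r).Adj c y →
      (fiberGraph n r).Adj c' y → False := fun y hy h1 h2 =>
    hno ((ReachableOff.of_adj h1 hc hy).trans (ReachableOff.of_adj h2.symm hy hc'))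
  by_cases hC : ∃ p ∈ permMoves ρ, ∃ p' ∈ permMoves ρ, p ≠ p' ∧ m + p = m' + p' ∧ m + p ≠ 0
  -- A collision away from `x` gives a common neighbour `y` of `c` and `c'`, hence `y ∈ X`. It is
  -- the only such collision and excludes `-m` and `-m'` from the moves along `ρ`, so `x` and `y`
  -- pay for `p` and `p'`.
  · obtain ⟨p, hp, p', hp', hne, heq, h0⟩ := hC
    have hmρ : -m ∉ permMoves ρ := fun h =>
      h0 (add_eq_zero_of_neg_mem_permMoves h hmM' hp hp' hne heq)
    have hmρ' : -m' ∉ permMoves ρ := fun h =>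
      h0 (heq.trans (add_eq_zero_of_neg_mem_permMoves h hmM hp' hp hne.symm heq.symm))
    obtain ⟨y, hy⟩ := exists_toInt_eq_add_permMove hρc hp
    have hy' : y.toInt = c'.toInt + p' := by rw [hy, hcx, hcx', add_assoc, heq, add_assoc]
    have hyX : y ∈ X := by
      by_contra hyX
      exact hpath y hyX (fiberGraph_adj_of_eq_add (permMoves_subset_markovMoves hp) hy)
        (fiberGraph_adj_of_eq_add (permMoves_subset_markovMoves hp') hy')
    have hyx : y ≠ x := by
      rintro rfl
      rw [hcx, add_assoc, left_eq_add] at hy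
      exact h0 hy
    rw [hcx, add_assoc] at hy
    rw [hcx', add_assoc] at hy'
    refine count {p, p'} {x, y} (by simp [Finset.insert_subset_iff, hx, hyX])
      (by rw [Finset.card_pair hne, Finset.card_pair hyx.symm]) (fun q hq hqB hqY => ?_)
      (fun q hq q' hq' hqB _ hqq h => ?_)
    · simp only [Finset.mem_insert, Finset.mem_singleton, not_or] at hqB hqY
      rcases hqY with hqY | hqY
      · rcases hgx q hq hqY with rfl | rfl
        · exact hmρ hq
        · exact hmρ' hq
      · have h1 := hg q hq
        rw [hqY] at h1
        rcases h1 with h1 | h1 | h1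
        · rw [hy, add_right_inj] at h1
          exact hqB.1 (add_left_cancel h1).symm
        · rw [hy, add_right_inj] at h1
          exact markovMoves_add_permMoves_ne hmM hp hq h1
        · rw [hy', add_right_inj] at h1
          exact hqB.2 (add_left_cancel h1).symm
    · have hsub : q - q' = p - p' := by
        have e1 : p - p' = m' - m := by rw [sub_eq_sub_iff_add_eq_add, add_comm, heq]
        have e2 : q - q' = m' - m := by rw [sub_eq_sub_iff_add_eq_add, add_comm, h]
        rw [e1, e2]
      have := permMoves_eq_of_sub_eq hq hq' hp hp' hqq hsub
      simp [this.1] at hqB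
  push Not at hC
  by_cases hA : -m ∈ permMoves ρ ∧ -m' ∈ permMoves ρ
  -- Both exceptional moves `-m`, `-m'` occur; the common neighbour `x + m + m'` exists, must lie in
  -- `X`, and pays for the second one.
  · obtain ⟨hmρ, hmρ'⟩ := hA
    obtain ⟨y, hy⟩ := exists_toInt_eq_add_add hσx hxc hxc' hmm hmρ hmρ'
    have hyX : y ∈ X := by
      by_contra hyX
      exact hpath y hyX (fiberGraph_adj_of_eq_add hmM' (by rw [hy, hcx, add_assoc]))
        (fiberGraph_adj_of_eq_add hmM (by rw [hy, hcx', add_assoc, add_comm m]))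
    have hyx : y ≠ x := by
      rintro rfl
      rw [left_eq_add] at hy
      exact permMoves_add_ne_zero hxc hxc' hy
    refine count {-m, -m'} {x, y} (by simp [Finset.insert_subset_iff, hx, hyX])
      (by rw [Finset.card_pair (by simpa using hmm), Finset.card_pair hyx.symm])
      (fun q hq hqB hqY => ?_) (fun q hq q' hq' hqB _ hqq h => ?_)
    · simp only [Finset.mem_insert, Finset.mem_singleton] at hqB hqY
      rcases hqY with hqY | hqY
      · exact hqB (hgx q hq hqY)
      · have h1 := hg q hq
        rw [hqY, hy] at h1
        simp only [add_right_inj] at h1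
        rcases h1 with h1 | h1 | h1
        · exact permMoves_add_ne_zero hmρ' hq (by rw [← h1]; simp)
        · have s1 := sum_permMoves hq
          have s2 := sum_permMoves hmρ
          have s3 := sum_permMoves hmρ'
          rw [← h1] at s1
          simp only [Matrix.add_apply, Matrix.neg_apply, Finset.sum_add_distrib,
            Finset.sum_neg_distrib] at s1 s2 s3
          omega
        · rw [add_comm m, add_right_inj] at h1
          exact permMoves_add_ne_zero hmρ hq (by rw [← h1]; simp)
    · have := hC q hq q' hq' hqq h
      simp [eq_neg_of_add_eq_zero_right this] at hqB
  -- At most one of `-m`, `-m'` is along `ρ`, so `x` alone pays for it.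
  · obtain ⟨z, hz⟩ : ∃ z, ∀ p ∈ permMoves ρ, p = -m ∨ p = -m' → p = z := by
      by_cases h : -m ∈ permMoves ρ
      · refine ⟨-m, ?_⟩
        rintro p hp (rfl | rfl)
        · rfl
        · exact absurd ⟨h, hp⟩ hA
      · refine ⟨-m', ?_⟩
        rintro p hp (rfl | rfl)
        · exact absurd hp h
        · rfl
    refine count {z} {x} (by simpa using hx) (by simp) (fun q hq hqB hqY => ?_)
      (fun q hq q' hq' hqB _ hqq h => ?_)
    · simp only [Finset.mem_singleton] at hqB hqY
      exact hqB (hz q hq (hgx q hq hqY))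
    · have := hC q hq q' hq' hqq h
      simp only [Finset.mem_singleton] at hqB
      exact hqB (hz q hq (Or.inl (eq_neg_of_add_eq_zero_right this)))

end Tables

/-! ### Assembling the bounds -/

section Main

variable {n r : ℕ}

/-- Descent on the entrywise distance to `y`: a suitable swap lowers it by at least 2. -/
theorem reachableOff_empty (x y : EqualSumTable n r) : ReachableOff (fiberGraph n r) ∅ x y := by
  obtain ⟨d, hd⟩ : ∃ d, d = ∑ i, ∑ j, (x.toInt i j - y.toInt i j).natAbs := ⟨_, rfl⟩
  induction d using Nat.strong_induction_on generalizing x with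
  | _ d ih =>
  have hrow : ∀ (z : EqualSumTable n r) i, ∑ j, z.toInt i j = r := fun z i => by
    simp only [EqualSumTable.toInt_apply]
    exact_mod_cast z.2.1 i
  have hcol : ∀ (z : EqualSumTable n r) j, ∑ i, z.toInt i j = r := fun z j => by
    simp only [EqualSumTable.toInt_apply]
    exact_mod_cast z.2.2 j
  have hrow' : ∀ i, ∑ j, (x.toInt i j - y.toInt i j) = 0 := fun i => by
    rw [Finset.sum_sub_distrib, hrow, hrow, sub_self]
  have hcol' : ∀ j, ∑ i, (x.toInt i j - y.toInt i j) = 0 := fun j => by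
    rw [Finset.sum_sub_distrib, hcol, hcol, sub_self]
  rcases eq_or_ne x y with rfl | hxy
  · exact Relation.ReflTransGen.refl
  obtain ⟨i, j, hij⟩ : ∃ i j, x.toInt i j - y.toInt i j ≠ 0 := by
    by_contra! hall
    exact hxy (EqualSumTable.toInt_injective (Matrix.ext fun i j => sub_eq_zero.1 (hall i j)))
  obtain ⟨j, -, hj⟩ := Finset.exists_pos_of_sum_zero_of_exists_nonzero _ (hrow' i)
    ⟨j, Finset.mem_univ j, hij⟩
  obtain ⟨l, hl⟩ : ∃ l, x.toInt i l - y.toInt i l < 0 := by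
    by_contra! hall
    exact hj.ne' ((Finset.sum_eq_zero_iff_of_nonneg fun l _ => hall l).1 (hrow' i) j
      (Finset.mem_univ j))
  obtain ⟨k, -, hk⟩ := Finset.exists_pos_of_sum_zero_of_exists_nonzero _ (hcol' l)
    ⟨i, Finset.mem_univ i, hl.ne⟩
  have hik : i ≠ k := by rintro rfl; omega
  have hjl : j ≠ l := by rintro rfl; omega
  have hm : swapMove i k j l ∈ markovMoves n := mem_markovMoves_iff.2 ⟨i, k, j, l, hik, hjl, rfl⟩
  have hnn : ∀ (z : EqualSumTable n r) a b, 0 ≤ z.toInt a b := fun z a b => by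
    rw [EqualSumTable.toInt_apply]; omega
  obtain ⟨z, hz⟩ := exists_toInt_eq_add x hm fun a b => by
    have h1 := swapMove_lower i k j l a b
    have h2 := hnn x a b
    have h3 := hnn y a b
    split_ifs at h1 with c1 c2 c2
    · exact absurd (c1.1.symm.trans c2.1) hik
    · obtain ⟨rfl, rfl⟩ := c1; omega
    · obtain ⟨rfl, rfl⟩ := c2; omega
    · omega
  have hxz : ReachableOff (fiberGraph n r) ∅ x z :=
    ReachableOff.of_adj (fiberGraph_adj_of_eq_add hm hz) (by simp) (by simp)
  refine hxz.trans (ih _ ?_ z rfl)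
  -- three of the four changed entries come closer to `y`
  have hle : ∀ a b, ((z.toInt a b - y.toInt a b).natAbs : ℤ) ≤
      (x.toInt a b - y.toInt a b).natAbs + ((if a = k then if b = j then 1 else 0 else 0)
        - (if a = i then if b = j then 1 else 0 else 0)
        - (if a = i then if b = l then 1 else 0 else 0)
        - (if a = k then if b = l then 1 else 0 else 0)) := by
    intro a b
    rw [hz, Matrix.add_apply]
    simp only [swapMove]
    split_ifs <;> subst_vars <;> omega
  rw [hd]
  zify
  refine lt_of_le_of_lt (Finset.sum_le_sum fun a _ => Finset.sum_le_sum fun b _ =>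
    (Int.natCast_natAbs _).symm.le.trans (hle a b)) ?_
  simp [Finset.sum_add_distrib, Finset.sum_sub_distrib]

theorem exists_perm_pos (hr : 2 < r) (x : EqualSumTable n r) :
    ∃ σ : Equiv.Perm (Fin n), ∀ i, 0 < x.1 i (σ i) :=
  exists_perm_pos_of_sum_eq (by omega) x.1 x.2.1 x.2.2

/-- Off a set `X` of fewer than `n.choose 2` vertices, any two neighbours of `x ∈ X` are joined
to each other. -/
theorem reachableOff_of_adj_adj (hr : 2 < r) {X : Finset (EqualSumTable n r)}
    (hX : X.card < n.choose 2) {x a b : EqualSumTable n r} (hx : x ∈ X) (ha : a ∉ X) (hb : b ∉ X)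
    (hxa : (fiberGraph n r).Adj x a) (hxb : (fiberGraph n r).Adj x b) :
    ReachableOff (fiberGraph n r) X a b := by
  obtain ⟨σ, τ, ρ, h⟩ := exists_three_perms_le hr x.1 x.2.1 x.2.2
  -- along each of two compatible permutations everything is joined, and the two are joined
  have hpos : ∀ φ : Equiv.Perm (Fin n), (∀ i j, (if φ i = j then 1 else 0) ≤ x.1 i j) →
      ∀ i, 0 < x.1 i (φ i) := fun φ hφ i => by
    have := hφ i (φ i)
    rw [if_pos rfl] at this
    omega
  have hσ := hpos σ fun i j => by have := h i j; omega
  have hτ := hpos τ fun i j => by have := h i j; omega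
  have hρ := hpos ρ fun i j => by have := h i j; omega
  have hcross : ∀ φ ψ : Equiv.Perm (Fin n),
      (∀ i j, (if φ i = j then 1 else 0) + (if ψ i = j then 1 else 0) ≤ x.1 i j) →
      ∀ c d, c ∉ X → d ∉ X → c.toInt - x.toInt ∈ permMoves φ →
        d.toInt - x.toInt ∈ permMoves ψ → ReachableOff (fiberGraph n r) X c d := by
    intro φ ψ hφψ c d hc hd hxc hxd
    have hψ := hpos ψ fun i j => by have := hφψ i j; omega
    have hψc : ∀ i, 0 < c.1 i (ψ i) := by
      intro i
      have h1 := hφψ i (ψ i)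
      have h2 := permMoves_lower hxc i (ψ i)
      rw [Matrix.sub_apply, EqualSumTable.toInt_apply, EqualSumTable.toInt_apply] at h2
      rw [if_pos (rfl : ψ i = ψ i)] at h1
      split_ifs at h1 h2 <;> omega
    -- Since `c` still dominates `ψ`, it reaches some `e` along `ψ`; then `φ` serves as the
    -- auxiliary permutation joining `e` to `d`.
    obtain ⟨e, he, hxe, hce⟩ := exists_reachableOff_permMoves hX hx hc
      (permMoves_subset_markovMoves hxc) hψ hψc
    exact hce.trans (reachableOff_of_permMoves hX hx
      (fun i j => (add_comm _ _).trans_le (hφψ i j)) he hd hxe hxd)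
  have hstar : ∀ a, a ∉ X → (fiberGraph n r).Adj x a → ∃ c, c ∉ X ∧
      c.toInt - x.toInt ∈ permMoves σ ∪ permMoves τ ∪ permMoves ρ ∧
      ReachableOff (fiberGraph n r) X a c := by
    intro a ha hxa
    suffices (∀ i, 0 < a.1 i (σ i)) ∨ (∀ i, 0 < a.1 i (τ i)) ∨ ∀ i, 0 < a.1 i (ρ i) by
      rcases this with h1 | h1 | h1
      · obtain ⟨c, hc, hxc, hac⟩ := exists_reachableOff_permMoves hX hx ha hxa hσ h1
        exact ⟨c, hc, by simp [hxc], hac⟩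
      · obtain ⟨c, hc, hxc, hac⟩ := exists_reachableOff_permMoves hX hx ha hxa hτ h1
        exact ⟨c, hc, by simp [hxc], hac⟩
      · obtain ⟨c, hc, hxc, hac⟩ := exists_reachableOff_permMoves hX hx ha hxa hρ h1
        exact ⟨c, hc, by simp [hxc], hac⟩
    obtain ⟨i, k, j, l, hik, hjl, hm⟩ := mem_markovMoves_iff.1 (fiberGraph_adj_iff.1 hxa)
    have hlow : ∀ p q, (x.1 p q : ℤ) ≤ a.1 p q +
        ((if p = i ∧ q = j then 1 else 0) + if p = k ∧ q = l then 1 else 0) := by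
      intro p q
      have h1 := swapMove_lower i k j l p q
      rw [← hm, Matrix.sub_apply, EqualSumTable.toInt_apply, EqualSumTable.toInt_apply] at h1
      linarith
    have hbad : ∀ φ : Equiv.Perm (Fin n), (∀ i, 0 < x.1 i (φ i)) → (¬∀ i, 0 < a.1 i (φ i)) →
        (φ i = j ∧ x.1 i j = 1) ∨ (φ k = l ∧ x.1 k l = 1) := by
      intro φ hφ hnot
      push Not at hnot
      obtain ⟨p, hp⟩ := hnot
      have h1 := hlow p (φ p)
      have h2 := hφ p
      split_ifs at h1 with c1 c2 c2
      · exact absurd (c1.1.symm.trans c2.1) hik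
      · obtain ⟨rfl, rfl⟩ := c1
        exact Or.inl ⟨rfl, by omega⟩
      · obtain ⟨rfl, rfl⟩ := c2
        exact Or.inr ⟨rfl, by omega⟩
      · omega
    by_contra! hnone
    have b1 := hbad σ hσ (by simpa using hnone.1)
    have b2 := hbad τ hτ (by simpa using hnone.2.1)
    have b3 := hbad ρ hρ (by simpa using hnone.2.2)
    -- By pigeonhole two of the three permutations are spoiled at the same lowered cell. Both pass
    -- through it, so `x` is at least 2 there, not 1.
    have h1 := h i j
    have h2 := h k l
    rcases b1 with ⟨e1, f1⟩ | ⟨e1, f1⟩ <;> rcases b2 with ⟨e2, f2⟩ | ⟨e2, f2⟩ <;>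
      rcases b3 with ⟨e3, f3⟩ | ⟨e3, f3⟩ <;> simp only [e1, e2, e3, if_true] at h1 h2 <;> omega
  obtain ⟨c, hc, hxc, hac⟩ := hstar a ha hxa
  obtain ⟨d, hd, hxd, hbd⟩ := hstar b hb hxb
  refine (hac.trans ?_).trans hbd.symm
  simp only [Finset.mem_union] at hxc hxd
  have hστ := hcross σ τ fun i j => by have := h i j; omega
  have hσρ := hcross σ ρ fun i j => by have := h i j; omega
  have hτρ := hcross τ ρ fun i j => by have := h i j; omega
  rcases hxc with (hxc | hxc) | hxc <;> rcases hxd with (hxd | hxd) | hxd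
  · exact reachableOff_of_permMoves hX hx (ρ := τ) (fun i j => by have := h i j; omega) hc hd hxc hxd
  · exact hστ c d hc hd hxc hxd
  · exact hσρ c d hc hd hxc hxd
  · exact (hστ d c hd hc hxd hxc).symm
  · exact reachableOff_of_permMoves hX hx (ρ := σ) (fun i j => by have := h i j; omega) hc hd hxc hxd
  · exact hτρ c d hc hd hxc hxd
  · exact (hσρ d c hd hc hxd hxc).symm
  · exact (hτρ d c hd hc hxd hxc).symm
  · exact reachableOff_of_permMoves hX hx (ρ := σ) (fun i j => by have := h i j; omega) hc hd hxc hxd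

theorem choose_two_le_degree (hr : 2 < r) (x : EqualSumTable n r) :
    n.choose 2 ≤ (fiberGraph n r).degree x := by
  obtain ⟨σ, hσ⟩ := exists_perm_pos hr x
  have : ∀ p ∈ permMoves σ, ∃ y : EqualSumTable n r, y.toInt = x.toInt + p :=
    fun p hp => exists_toInt_eq_add_permMove hσ hp
  choose! g hg using this
  rw [← card_permMoves σ, ← SimpleGraph.card_neighborFinset_eq_degree]
  refine Finset.card_le_card_of_injOn g (fun p hp => ?_) fun p hp q hq hpq => ?_
  · exact ((fiberGraph n r).mem_neighborFinset x _).2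
      (fiberGraph_adj_of_eq_add (permMoves_subset_markovMoves hp) (hg p hp))
  · have := hg p hp
    rw [hpq, hg q hq] at this
    exact (add_left_cancel this).symm

theorem exists_degree_le_choose_two (n r : ℕ) :
    ∃ x : EqualSumTable n r, (fiberGraph n r).degree x ≤ n.choose 2 := by
  let x : EqualSumTable n r := ⟨fun i j => if i = j then r else 0, by simp, by simp⟩
  refine ⟨x, ?_⟩
  rw [← card_permMoves (Equiv.refl (Fin n)), ← SimpleGraph.card_neighborFinset_eq_degree]
  refine Finset.card_le_card_of_injOn (fun y => y.toInt - x.toInt) (fun y hy => ?_)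
    fun y _ z _ h => EqualSumTable.toInt_injective (sub_left_injective h)
  have hxy := ((fiberGraph n r).mem_neighborFinset x y).1 hy
  obtain ⟨i, k, j, l, hik, hjl, hm⟩ := mem_markovMoves_iff.1 (fiberGraph_adj_iff.1 hxy)
  have hdiag : ∀ a b, swapMove i k j l a b < 0 → a = b := by
    intro a b hab
    by_contra hne
    have h1 : (y.1 a b : ℤ) - ((if a = b then r else 0 : ℕ) : ℤ) = swapMove i k j l a b :=
      congrFun (congrFun hm a) b
    rw [if_neg hne] at h1
    omega
  have h1 : i = j := hdiag i j (by simp [swapMove, hik, hjl])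
  have h2 : k = l := hdiag k l (by simp [swapMove, hik.symm, hjl.symm])
  subst h1 h2
  exact mem_permMoves_iff.2 ⟨i, k, hik, hm⟩

theorem isKConnected_fiberGraph (hr : 2 < r) : IsKConnected (fiberGraph n r) (n.choose 2) := by
  have hcard : n.choose 2 < Fintype.card (EqualSumTable n r) :=
    (choose_two_le_degree hr (Classical.arbitrary _)).trans_lt
      ((fiberGraph n r).degree_lt_card_verts _)
  refine ⟨hcard, fun X hX => ?_⟩
  have hreach := reachableOff_of_neighbors (N := n.choose 2) (reachableOff_empty (n := n) (r := r))
    (fun X hX x hx a b ha hb hxa hxb => reachableOff_of_adj_adj hr hX hx ha hb hxa hxb) X hX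
  obtain ⟨v, hv⟩ : ∃ v, v ∉ X := by
    by_contra! hall
    rw [Finset.eq_univ_iff_forall.2 hall, Finset.card_univ] at hX
    omega
  have : Nonempty {v : EqualSumTable n r | v ∉ X} := ⟨⟨v, hv⟩⟩
  refine ⟨fun a b => ?_⟩
  obtain ⟨_, h⟩ := (hreach a.1 b.1 a.2 b.2).reachable_induce a.2
  exact h

end Main

theorem mainTheorem1 (n r : ℕ) (hr : 2 < r) :
    vertexConnectivity (fiberGraph n r) = n.choose 2 ∧
      (fiberGraph n r).minDegree = n.choose 2 := by
  have hgreatest := isGreatest_vertexConnectivity (fiberGraph n r)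
  obtain ⟨x, hx⟩ := exists_degree_le_choose_two n r
  refine ⟨le_antisymm ((IsKConnected.le_degree hgreatest.1 x).trans hx)
    (hgreatest.2 (isKConnected_fiberGraph hr)), le_antisymm ?_ ?_⟩
  · exact ((fiberGraph n r).minDegree_le_degree x).trans hx
  · exact (fiberGraph n r).le_minDegree_of_forall_le_degree _ (choose_two_le_degree hr)
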